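/- Let $n$ be the number of assets. For each asset $i=1,\dots,n$ let strikes $K_i^j\ge 0$ and call prices $p_i^j\ge 0$, $j=1,\dots,J^i$, be given, and let $K_0\ge 0$ and $w_0\in\mathbf R^n$ with all components strictly positive. Assume that the prices are consistent, i.e. that there is at least one probability measure $\pi$ on $\mathbf R_+^n$ with $\mathbf E_\pi (x_i-K_i^j)_+=p_i^j$ for all $i=1,\dots,n$, $j=1,\dots,J^i$. Then the following two problems have the same optimal value (supremum in $[-\infty,+\infty]$). (1) The exact upper bound problem \[ \text{maximize } \mathbf E_\pi (w_0^Tx-K_0)_+\quad\text{subject to}\quad \mathbf E_\pi (x_i-K_i^j)_+=p_i^j,\quad i=1,\dots,n,\ j=1,\dots,J^i, \] over probability measures $\pi$ on $\mathbf R_+^n$. (2) The finite linear program whose data points are the target call $(w_0,K_0)$ with price $p_0$, the basket forward $(w_0,0)$ with price $w_0^Tq$, and the single-asset calls $(e_i,K_i^j)$ with prices $p_i^j$, $i=1,\dots,n$, $j=1,\dots,J^i$, where $e_i$ is the $i$-th unit vector. Writing these points as $(w_a,k_a)$ and their prices as $\hat p_a$, with $a$ in a finite index set $A$, the program is \[ \begin{array}{ll}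 \text{maximize} & p_0\\ \text{subject to} & \langle g_a,(w_b,k_b)-(w_a,k_a)\rangle\le \hat p_b-\hat p_a,\quad a,b\in A,\\ & g_{a,i}\ge 0,\ \ -1\le g_{a,n+1}\le 0,\quad a\in A,\ i=1,\dots,n,\\ & \langle g_a,(w_a,k_a)\rangle=\hat p_a,\quad a\in A,\\ & q_i=p_i^j \ \text{ whenever } K_i^j=0, \end{array} \] in the variables $p_0\in\mathbf R_+$, $q\in\mathbf R_+^n$ and $g_a\in\mathbf R^{n+1}$, $a\in A$. Here $\langle g,(w,k)\rangle=\sum_{i=1}^n g_iw_i+g_{n+1}k$. -/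

import Mathlib

open MeasureTheory
open scoped ENNReal

noncomputable section

/-- Pricing measures: probability measures `π` on `ℝⁿ`, supported in the closed orthant `ℝ₊ⁿ`,
that reproduce the single-asset call prices `E_π (x_i - K_i^j)_+ = p_i^j`, `j < J i`.
Expectations of nonnegative variables are taken in `[0, ∞]`. -/
structure IsPricingMeasure {n : ℕ} (J : Fin n → ℕ) (K p : (i : Fin n) → Fin (J i) → ℝ)
    (π : Measure (Fin n → ℝ)) : Prop where
  prob : IsProbabilityMeasure π
  nonneg : ∀ᵐ x ∂π, ∀ i, 0 ≤ x i
  price : ∀ (i : Fin n) (j : Fin (J i)),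
    ∫⁻ x, ENNReal.ofReal (max (x i - K i j) 0) ∂π = ENNReal.ofReal (p i j)

/-- The price `E_π (wᵀx - k)_+ ∈ [0, ∞]` of the basket call with weights `w` and strike `k`. -/
def basketCallPrice {n : ℕ} (w : Fin n → ℝ) (k : ℝ) (π : Measure (Fin n → ℝ)) : ℝ≥0∞ :=
  ∫⁻ x, ENNReal.ofReal (max (w ⬝ᵥ x - k) 0) ∂π

/-- Optimal value (in `[-∞, ∞]`) of the exact problem: maximize the price of the basket call
over all pricing measures. -/
def exactUpperBound {n : ℕ} (J : Fin n → ℕ) (K p : (i : Fin n) → Fin (J i) → ℝ)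
    (w₀ : Fin n → ℝ) (K₀ : ℝ) : EReal :=
  sSup {v : EReal | ∃ π : Measure (Fin n → ℝ), IsPricingMeasure J K p π ∧
    v = (basketCallPrice w₀ K₀ π : EReal)}

/-- The data points of the linear program. `Sum.inl 0` is the target `(w₀, K₀)`, `Sum.inl 1` is the
basket forward `(w₀, 0)`, and `Sum.inr ⟨i, j⟩` is the single-asset call `(e_i, K_i^j)`. -/
abbrev Node {n : ℕ} (J : Fin n → ℕ) : Type := Fin 2 ⊕ ((i : Fin n) × Fin (J i))

/-- The weight vector of a data point. -/
def nodeWeight {n : ℕ} (J : Fin n → ℕ) (w₀ : Fin n → ℝ) : Node J → (Fin n → ℝ)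
  | Sum.inl _ => w₀
  | Sum.inr a => Pi.single a.1 1

/-- The strike of a data point. -/
def nodeStrike {n : ℕ} (J : Fin n → ℕ) (K : (i : Fin n) → Fin (J i) → ℝ) (K₀ : ℝ) :
    Node J → ℝ
  | Sum.inl l => if l = 0 then K₀ else 0
  | Sum.inr a => K a.1 a.2

/-- The price at a data point: `p₀` at `(w₀, K₀)`, `w₀ᵀq` at `(w₀, 0)` and `p_i^j` at
`(e_i, K_i^j)`. -/
def nodePrice {n : ℕ} (J : Fin n → ℕ) (p : (i : Fin n) → Fin (J i) → ℝ) (w₀ : Fin n → ℝ)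
    (p₀ : ℝ) (q : Fin n → ℝ) : Node J → ℝ
  | Sum.inl l => if l = 0 then p₀ else w₀ ⬝ᵥ q
  | Sum.inr a => p a.1 a.2

/-- The pairing `⟨g, (w, k)⟩ = g̃ᵀw + g_{n+1} k` for `g = (g̃, g_{n+1})`. -/
def pairing {n : ℕ} (g : (Fin n → ℝ) × ℝ) (w : Fin n → ℝ) (k : ℝ) : ℝ :=
  g.1 ⬝ᵥ w + g.2 * k

/-- Feasible points of the finite linear program. The variables are the target price `p₀`, the
forward prices `q` (equal to the quoted price of any call of strike zero) and one subgradient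
`g a` of the call price function per data point `a`. -/
structure IsLPFeasible {n : ℕ} (J : Fin n → ℕ) (K p : (i : Fin n) → Fin (J i) → ℝ)
    (w₀ : Fin n → ℝ) (K₀ : ℝ) (p₀ : ℝ) (q : Fin n → ℝ) (g : Node J → (Fin n → ℝ) × ℝ) :
    Prop where
  target_nonneg : 0 ≤ p₀
  forward_nonneg : ∀ i, 0 ≤ q i
  forward_quoted : ∀ (i : Fin n) (j : Fin (J i)), K i j = 0 → q i = p i j
  /-- convexity -/
  convex : ∀ a b : Node J,
    pairing (g a) (nodeWeight J w₀ b - nodeWeight J w₀ a) (nodeStrike J K K₀ b - nodeStrike J K K₀ a)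
      ≤ nodePrice J p w₀ p₀ q b - nodePrice J p w₀ p₀ q a
  /-- monotonicity in the weights -/
  mono : ∀ (a : Node J) (i : Fin n), 0 ≤ (g a).1 i
  /-- the slope in the strike lies in `[-1, 0]` -/
  slope : ∀ a : Node J, -1 ≤ (g a).2 ∧ (g a).2 ≤ 0
  /-- homogeneity of degree one -/
  homogeneous : ∀ a : Node J,
    pairing (g a) (nodeWeight J w₀ a) (nodeStrike J K K₀ a) = nodePrice J p w₀ p₀ q a

/-- Optimal value (in `[-∞, ∞]`) of the finite linear program: maximize `p₀`. -/
def lpUpperBound {n : ℕ} (J : Fin n → ℕ) (K p : (i : Fin n) → Fin (J i) → ℝ)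
    (w₀ : Fin n → ℝ) (K₀ : ℝ) : EReal :=
  sSup {v : EReal | ∃ (p₀ : ℝ) (q : Fin n → ℝ) (g : Node J → (Fin n → ℝ) × ℝ),
    IsLPFeasible J K p w₀ K₀ p₀ q g ∧ v = (p₀ : EReal)}

end

/-! Exact ≤ LP: for a pricing measure with finite means, C(w, k) = E(wᵀx - k)₊ is convex and
homogeneous of degree one, and (E[x; wᵀx > k], -P(wᵀx > k)) is a subgradient of C at (w, k). These
subgradients and the means form a feasible point with p₀ = C(w₀, K₀). Infinite means occur only for
assets without quotes; capping those assets leaves the constraints intact, and monotone convergence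
removes the cap.

LP ≤ exact: one subgradient (h, -s), at the target, suffices. Homogeneity gives p₀ = hᵀw₀ - sK₀, and
convexity towards (e_i, K_i^j) gives h_i ≤ p_i^j + s K_i^j. It remains to find a pricing measure
with an event of probability s on which asset i contributes at least h_i to the mean: exercising the
basket call on that event is worth at least hᵀw₀ - sK₀.

The problem then splits by asset (`exists_mixture_le_mean`). Let K minimize p_i^j + s K_i^j over the
quoted strikes. Minimality bounds the slopes of the call price on both sides of K by -s. Spread the
mass between K and its neighbouring strikes to the endpoints: quoted prices do not change, at most s
of the mass is then above K and at most 1 - s below. Splitting the atom at K completes the upper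
part to mass exactly s, and its contribution to the mean is the minimum p + sK ≥ h_i. Mixing the
products of the upper and of the lower parts with the same s lets all assets be high together. -/

/-- Transport the part of `μ` with density `v` along `T` and complete it to mass `c` at the
point `z`. -/
theorem exists_isProbabilityMeasure_transport {α : Type*} [MeasurableSpace α]
    (μ : Measure α) {v : α → ℝ≥0∞} (hv : Measurable v) {T : α → α}
    (hT : Measurable T) (z : α) {c : ℝ≥0∞} (hc : c ≠ 0) (hc' : c ≠ ∞)
    (hvc : ∫⁻ x, v x ∂μ ≤ c) :
    ∃ ν : Measure α, IsProbabilityMeasure ν ∧ ∀ f : α → ℝ≥0∞, Measurable f →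
      c * ∫⁻ x, f x ∂ν = ∫⁻ x, v x * f (T x) ∂μ + (c - ∫⁻ x, v x ∂μ) * f z := by
  set ν : Measure α := c⁻¹ • ((μ.withDensity v).map T + (c - ∫⁻ x, v x ∂μ) • Measure.dirac z)
    with hν
  have key : ∀ f : α → ℝ≥0∞, Measurable f →
      c * ∫⁻ x, f x ∂ν = ∫⁻ x, v x * f (T x) ∂μ + (c - ∫⁻ x, v x ∂μ) * f z := by
    intro f hf
    rw [hν, lintegral_smul_measure, lintegral_add_measure, lintegral_smul_measure,
      lintegral_map hf hT,
      show ∫⁻ x, f (T x) ∂(μ.withDensity v) = ∫⁻ x, v x * f (T x) ∂μ from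
        lintegral_withDensity_eq_lintegral_mul _ hv (hf.comp hT),
      lintegral_dirac' _ hf, smul_eq_mul, smul_eq_mul, ← mul_assoc,
      ENNReal.mul_inv_cancel hc hc', one_mul]
  refine ⟨ν, ⟨?_⟩, key⟩
  have h := key (fun _ => 1) measurable_const
  simp only [lintegral_const, one_mul, mul_one] at h
  rw [add_tsub_cancel_of_le hvc] at h
  have h2 : c * ν Set.univ = c * 1 := by rw [h, mul_one]
  exact (ENNReal.mul_right_inj hc hc').1 h2

/-! ### Ramps and mass spreads on the line -/

/-- The piecewise linear function increasing from `0` at `a` to `1` at `b`; zero if `a = b`. -/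
noncomputable def ramp (a b x : ℝ) : ℝ := min 1 (max 0 ((x - a) / (b - a)))

theorem measurable_ramp (a b : ℝ) : Measurable (ramp a b) := by
  unfold ramp; fun_prop

theorem ramp_nonneg (a b x : ℝ) : 0 ≤ ramp a b x := by
  unfold ramp; exact le_min zero_le_one (le_max_left _ _)

theorem ramp_eq_zero {a b x : ℝ} (hab : a ≤ b) (h : x ≤ a) : ramp a b x = 0 := by
  unfold ramp
  rw [max_eq_left (div_nonpos_of_nonpos_of_nonneg (by linarith) (by linarith)),
    min_eq_right zero_le_one]

theorem ramp_eq_one {a b x : ℝ} (hab : a < b) (h : b ≤ x) : ramp a b x = 1 := by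
  unfold ramp
  apply min_eq_left
  apply le_max_of_le_right
  rw [le_div_iff₀ (by linarith)]; linarith

theorem ramp_eq_div {a b x : ℝ} (hab : a < b) (h : a ≤ x) (h' : x ≤ b) :
    ramp a b x = (x - a) / (b - a) := by
  unfold ramp
  rw [max_eq_right (div_nonneg (by linarith) (by linarith)), min_eq_right]
  rw [div_le_one (by linarith)]; linarith

/-- A ramp is a normalized call spread, so its expectation is minus a difference quotient of the
call price in the strike. -/
theorem mul_ramp {a b x : ℝ} (hab : a < b) :
    (b - a) * ramp a b x = max (x - a) 0 - max (x - b) 0 := by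
  have hne : b - a ≠ 0 := by linarith
  rcases le_total x a with h | h
  · rw [ramp_eq_zero hab.le h, max_eq_right (by linarith), max_eq_right (by linarith)]; ring
  rcases le_total x b with h' | h'
  · rw [ramp_eq_div hab h h', max_eq_left (by linarith), max_eq_right (by linarith)]
    field_simp; ring
  · rw [ramp_eq_one hab h', max_eq_left (by linarith), max_eq_left (by linarith)]; ring

theorem ramp_mul_max_sub {K b x : ℝ} (hb : K < b) :
    ramp K b x * (max x b - K) = max (x - K) 0 := by
  have := mul_ramp (x := x) hb
  rcases le_total x b with h | h
  · rw [max_eq_right h, mul_comm, this, max_eq_right (b := (0 : ℝ)) (a := x - b) (by linarith)]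
    ring
  · rw [ramp_eq_one hb h, max_eq_left h, max_eq_left (by linarith)]; ring

/-- The density moved down to `min x a` when mass between `a` and `K` is spread to the endpoints;
zero if `a = K`. -/
noncomputable def lowerRamp (a K x : ℝ) : ℝ := if a < K then 1 - ramp a K x else 0

theorem measurable_lowerRamp (a K : ℝ) : Measurable (lowerRamp a K) := by
  unfold lowerRamp
  split_ifs
  · exact measurable_const.sub (measurable_ramp a K)
  · exact measurable_const

theorem ramp_le_one (a b x : ℝ) : ramp a b x ≤ 1 := min_le_left _ _

theorem lowerRamp_nonneg (a K x : ℝ) : 0 ≤ lowerRamp a K x := by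
  unfold lowerRamp
  split_ifs
  · linarith [ramp_le_one a K x]
  · exact le_rfl

theorem lowerRamp_eq_zero {a K x : ℝ} (h : K ≤ x) : lowerRamp a K x = 0 := by
  unfold lowerRamp
  split_ifs with ha
  · rw [ramp_eq_one ha h, sub_self]
  · rfl

theorem lowerRamp_le_one (a K x : ℝ) : lowerRamp a K x ≤ 1 := by
  unfold lowerRamp
  split_ifs
  · linarith [ramp_nonneg a K x]
  · exact zero_le_one

theorem ramp_add_lowerRamp_le_one {a K b : ℝ} (hb : K < b) (x : ℝ) :
    ramp K b x + lowerRamp a K x ≤ 1 := by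
  rcases le_total x K with h | h
  · rw [ramp_eq_zero hb.le h, zero_add]; exact lowerRamp_le_one _ _ _
  · rw [lowerRamp_eq_zero h, add_zero]; exact ramp_le_one _ _ _

/-- Spreading mass from `(a, K)` and `(K, b)` to the endpoints preserves call payoffs whose strike
is not in the interior of these intervals. -/
theorem call_spread {a K b k : ℝ} (hb : K < b) (hk : k = K ∨ b ≤ k ∨ (a < K ∧ k ≤ a)) (x : ℝ) :
    ramp K b x * max (max x b - k) 0 + lowerRamp a K x * max (min x a - k) 0
      + (1 - ramp K b x - lowerRamp a K x) * max (K - k) 0 = max (x - k) 0 := by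
  have hbK : b - K ≠ 0 := by linarith
  rcases le_total K x with h | h
  · rw [lowerRamp_eq_zero h]
    have h1 := ramp_mul_max_sub (x := x) hb
    rw [max_eq_left (a := x - K) (by linarith)] at h1
    rcases le_or_gt k K with h' | h'
    · rw [max_eq_left (a := K - k) (by linarith), max_eq_left (a := x - k) (by linarith),
        max_eq_left (a := max x b - k) (by linarith [le_max_right x b])]
      linarith
    · have hbk : b ≤ k := by
        rcases hk with h2 | h2 | h2
        · linarith
        · exact h2
        · linarith [h2.1, h2.2]
      rw [max_eq_right (a := K - k) (by linarith)]
      rcases le_total x b with h3 | h3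
      · rw [max_eq_right h3, max_eq_right (a := b - k) (by linarith),
          max_eq_right (a := x - k) (by linarith)]
        ring
      · rw [max_eq_left h3, ramp_eq_one hb h3]; ring
  · rw [ramp_eq_zero hb.le h]
    unfold lowerRamp
    split_ifs with ha
    · have haK : K - a ≠ 0 := by linarith
      rcases le_or_gt K k with h' | h'
      · rw [max_eq_right (a := K - k) (by linarith), max_eq_right (a := x - k) (by linarith),
          max_eq_right (a := min x a - k) (by linarith [min_le_left x a])]
        ring
      · have hka : k ≤ a := by
          rcases hk with h2 | h2 | h2
          · linarith
          · linarith
          · exact h2.2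
        rcases le_total x a with h3 | h3
        · rw [ramp_eq_zero ha.le h3, min_eq_left h3]; ring
        · rw [ramp_eq_div ha h3 h, min_eq_right h3, max_eq_left (a := K - k) (by linarith),
            max_eq_left (a := x - k) (by linarith), max_eq_left (a := a - k) (by linarith)]
          field_simp; ring
    -- In the degenerate case all mass below `K` moves up to `K`, which only strikes `k ≥ K` do not
    -- notice.
    · have : K ≤ k := by
        rcases hk with h2 | h2 | h2
        · linarith
        · linarith
        · exact absurd h2.1 ha
      rw [max_eq_right (a := K - k) (by linarith), max_eq_right (a := x - k) (by linarith)]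
      ring

/-! ### Splitting a one-dimensional law at a strike -/

/-- Decompose a spread of `μ` as a mixture `s ν + (1 - s) ρ` with `ν` above `K` and `ρ` below `K`,
keeping the call prices. -/
theorem exists_mixture_of_spread (μ : Measure ℝ) [IsProbabilityMeasure μ]
    (hμ : ∀ᵐ x ∂μ, 0 ≤ x) {s a K b : ℝ} (hs : 0 < s) (hs' : s < 1) (ha : 0 ≤ a) (haK : a ≤ K)
    (hb : K < b) (hu : ∫⁻ x, ENNReal.ofReal (ramp K b x) ∂μ ≤ ENNReal.ofReal s)
    (hl : ∫⁻ x, ENNReal.ofReal (lowerRamp a K x) ∂μ ≤ ENNReal.ofReal (1 - s)) :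
    ∃ ν ρ : Measure ℝ, IsProbabilityMeasure ν ∧ IsProbabilityMeasure ρ ∧
      (∀ᵐ x ∂ν, 0 ≤ x) ∧ (∀ᵐ x ∂ρ, 0 ≤ x) ∧
      (∀ k, (k = K ∨ b ≤ k ∨ (a < K ∧ k ≤ a)) →
        ENNReal.ofReal s * ∫⁻ x, ENNReal.ofReal (max (x - k) 0) ∂ν +
          ENNReal.ofReal (1 - s) * ∫⁻ x, ENNReal.ofReal (max (x - k) 0) ∂ρ =
          ∫⁻ x, ENNReal.ofReal (max (x - k) 0) ∂μ) ∧
      ENNReal.ofReal s * ∫⁻ x, ENNReal.ofReal x ∂ν =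
        ∫⁻ x, ENNReal.ofReal (max (x - K) 0) ∂μ + ENNReal.ofReal (s * K) := by
  have hK : 0 ≤ K := ha.trans haK
  have mu : Measurable fun x => ENNReal.ofReal (ramp K b x) := (measurable_ramp K b).ennreal_ofReal
  have ml : Measurable fun x => ENNReal.ofReal (lowerRamp a K x) :=
    (measurable_lowerRamp a K).ennreal_ofReal
  -- The share `ramp K b x` of the mass at `x` goes to `max x b`; an atom at `K` fills this part up
  -- to mass `s`. The lower part `ρ` is completed to `1 - s` in the same way.
  obtain ⟨ν, hν, hνf⟩ := exists_isProbabilityMeasure_transport μ mu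
    (T := fun x => max x b) (by fun_prop) K (c := ENNReal.ofReal s) (by simpa using hs)
    ENNReal.ofReal_ne_top hu
  obtain ⟨ρ, hρ, hρf⟩ := exists_isProbabilityMeasure_transport μ ml
    (T := fun x => min x a) (by fun_prop) K (c := ENNReal.ofReal (1 - s)) (by simpa using hs')
    ENNReal.ofReal_ne_top hl
  have mneg : Measurable ((Set.Iio (0 : ℝ)).indicator (fun _ => (1 : ℝ≥0∞))) :=
    measurable_const.indicator measurableSet_Iio
  have hK0 : (Set.Iio (0 : ℝ)).indicator (fun _ => (1 : ℝ≥0∞)) K = 0 := by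
    simp [hK]
  refine ⟨ν, ρ, hν, hρ, ?_, ?_, ?_, ?_⟩
  · have h := hνf _ mneg
    rw [lintegral_indicator_const measurableSet_Iio, one_mul, hK0, mul_zero, add_zero,
      lintegral_eq_zero_iff' (by fun_prop) |>.2 ?_] at h
    · have h2 : ν (Set.Iio 0) = 0 := by
        rcases mul_eq_zero.1 h with h2 | h2
        · simp at h2; linarith
        · exact h2
      rw [ae_iff]
      convert h2 using 2
      ext x; simp
    · refine Filter.Eventually.of_forall fun x => ?_
      have : 0 ≤ max x b := (hK.trans hb.le).trans (le_max_right _ _)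
      simp only [Pi.zero_apply]
      rw [Set.indicator_of_notMem (by simpa only [Set.mem_Iio, not_lt] using this), mul_zero]
  · have h := hρf _ mneg
    rw [lintegral_indicator_const measurableSet_Iio, one_mul, hK0, mul_zero, add_zero,
      lintegral_eq_zero_iff' (by fun_prop) |>.2 ?_] at h
    · have h2 : ρ (Set.Iio 0) = 0 := by
        rcases mul_eq_zero.1 h with h2 | h2
        · simp at h2; linarith
        · exact h2
      rw [ae_iff]
      convert h2 using 2
      ext x; simp
    · filter_upwards [hμ] with x hx
      have : 0 ≤ min x a := le_min hx ha
      simp only [Pi.zero_apply]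
      rw [Set.indicator_of_notMem (by simpa only [Set.mem_Iio, not_lt] using this), mul_zero]
  · intro k hk
    rw [hνf _ (by fun_prop), hρf _ (by fun_prop)]
    -- The two atoms at `K` together carry exactly the mass that the spread puts at `K`, because `s
    -- + (1 - s) = 1`.
    have hrest : (ENNReal.ofReal s - ∫⁻ x, ENNReal.ofReal (ramp K b x) ∂μ) +
        (ENNReal.ofReal (1 - s) - ∫⁻ x, ENNReal.ofReal (lowerRamp a K x) ∂μ) =
        ∫⁻ x, ENNReal.ofReal (1 - ramp K b x - lowerRamp a K x) ∂μ := by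
      have hsum : (∫⁻ x, ENNReal.ofReal (ramp K b x) ∂μ) +
          (∫⁻ x, ENNReal.ofReal (lowerRamp a K x) ∂μ) +
          ∫⁻ x, ENNReal.ofReal (1 - ramp K b x - lowerRamp a K x) ∂μ = 1 := by
        rw [← lintegral_add_left mu, ← lintegral_add_left (by fun_prop)]
        rw [← measure_univ (μ := μ), ← lintegral_one]
        refine lintegral_congr fun x => ?_
        rw [← ENNReal.ofReal_add (ramp_nonneg _ _ _) (lowerRamp_nonneg _ _ _),
          ← ENNReal.ofReal_add (add_nonneg (ramp_nonneg _ _ _) (lowerRamp_nonneg _ _ _))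
            (by linarith [ramp_add_lowerRamp_le_one (a := a) hb x])]
        simp
      have hone : ENNReal.ofReal s + ENNReal.ofReal (1 - s) = 1 := by
        rw [← ENNReal.ofReal_add hs.le (by linarith)]; simp
      have h1 : (∫⁻ x, ENNReal.ofReal (ramp K b x) ∂μ) ≠ ∞ :=
        ne_top_of_le_ne_top ENNReal.ofReal_ne_top hu
      have h2 : (∫⁻ x, ENNReal.ofReal (lowerRamp a K x) ∂μ) ≠ ∞ :=
        ne_top_of_le_ne_top ENNReal.ofReal_ne_top hl
      refine (ENNReal.add_right_inj (ENNReal.add_ne_top.2 ⟨h1, h2⟩)).1 ?_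
      rw [hsum, ← hone, add_add_add_comm, add_tsub_cancel_of_le hu, add_tsub_cancel_of_le hl]
    have h3 : ∀ A B C D E : ℝ≥0∞, A + B * E + (C + D * E) = A + C + (B + D) * E := by
      intros; ring
    have mrest : Measurable fun x => ENNReal.ofReal (1 - ramp K b x - lowerRamp a K x) :=
      ((measurable_const.sub (measurable_ramp K b)).sub
        (measurable_lowerRamp a K)).ennreal_ofReal
    rw [h3, hrest, ← lintegral_mul_const _ mrest, ← lintegral_add_left (by fun_prop),
      ← lintegral_add_left (by fun_prop)]
    refine lintegral_congr fun x => ?_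
    rw [← call_spread (a := a) hb hk x, ENNReal.ofReal_add, ENNReal.ofReal_add,
      ENNReal.ofReal_mul (ramp_nonneg _ _ _), ENNReal.ofReal_mul (lowerRamp_nonneg _ _ _),
      ENNReal.ofReal_mul (by linarith [ramp_add_lowerRamp_le_one (a := a) hb x])]
    · exact mul_nonneg (ramp_nonneg _ _ _) (le_max_right _ _)
    · exact mul_nonneg (lowerRamp_nonneg _ _ _) (le_max_right _ _)
    · exact add_nonneg (mul_nonneg (ramp_nonneg _ _ _) (le_max_right _ _))
        (mul_nonneg (lowerRamp_nonneg _ _ _) (le_max_right _ _))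
    · exact mul_nonneg (by linarith [ramp_add_lowerRamp_le_one (a := a) hb x]) (le_max_right _ _)
  · rw [hνf _ (by fun_prop)]
    -- The upper part carries the whole payoff above `K`, and its mass `s` lies in `[K, ∞)`, so its
    -- mean is that payoff plus `s * K`.
    have h1 : ∫⁻ x, ENNReal.ofReal (ramp K b x) * ENNReal.ofReal (max x b) ∂μ =
        ∫⁻ x, ENNReal.ofReal (max (x - K) 0) ∂μ +
          (∫⁻ x, ENNReal.ofReal (ramp K b x) ∂μ) * ENNReal.ofReal K := by
      rw [← lintegral_mul_const _ mu, ← lintegral_add_left (by fun_prop)]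
      refine lintegral_congr fun x => ?_
      rw [← ENNReal.ofReal_mul (ramp_nonneg _ _ _), ← ENNReal.ofReal_mul (ramp_nonneg _ _ _),
        ← ENNReal.ofReal_add (le_max_right _ _) (mul_nonneg (ramp_nonneg _ _ _) hK),
        ← ramp_mul_max_sub hb]
      congr 1; ring
    rw [h1, add_assoc, ← add_mul, add_tsub_cancel_of_le hu, ENNReal.ofReal_mul hs.le]

/-- A slope of at least `-s` on `[a, b]` bounds the mass of the call spread by `s`. A mere lower
bound `B` on the price at `b` is enough, so `B = 0` serves beyond the last strike. -/
theorem lintegral_ramp_le (μ : Measure ℝ) {a b s A B : ℝ} (hab : a < b) (hs : 0 ≤ s)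
    (hB : 0 ≤ B)
    (hA : ∫⁻ x, ENNReal.ofReal (max (x - a) 0) ∂μ = ENNReal.ofReal A)
    (hB' : ENNReal.ofReal B ≤ ∫⁻ x, ENNReal.ofReal (max (x - b) 0) ∂μ)
    (h : A ≤ B + s * (b - a)) :
    ∫⁻ x, ENNReal.ofReal (ramp a b x) ∂μ ≤ ENNReal.ofReal s := by
  have mu : Measurable fun x => ENNReal.ofReal (ramp a b x) := (measurable_ramp a b).ennreal_ofReal
  have h1 : ENNReal.ofReal (b - a) * (∫⁻ x, ENNReal.ofReal (ramp a b x) ∂μ) +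
      ∫⁻ x, ENNReal.ofReal (max (x - b) 0) ∂μ = ENNReal.ofReal A := by
    rw [← hA, ← lintegral_const_mul _ mu, ← lintegral_add_left (by fun_prop)]
    refine lintegral_congr fun x => ?_
    rw [← ENNReal.ofReal_mul (by linarith), mul_ramp hab, ← ENNReal.ofReal_add _ (le_max_right _ _)]
    · congr 1; ring
    · rw [← mul_ramp hab]; exact mul_nonneg (by linarith) (ramp_nonneg _ _ _)
  have h2 : ENNReal.ofReal (b - a) * (∫⁻ x, ENNReal.ofReal (ramp a b x) ∂μ) + ENNReal.ofReal B ≤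
      ENNReal.ofReal (b - a) * ENNReal.ofReal s + ENNReal.ofReal B := by
    calc _ ≤ ENNReal.ofReal A := by rw [← h1]; gcongr
      _ ≤ ENNReal.ofReal ((b - a) * s + B) := ENNReal.ofReal_le_ofReal (by linarith)
      _ = _ := by
        rw [ENNReal.ofReal_add (mul_nonneg (by linarith) hs) hB, ENNReal.ofReal_mul (by linarith)]
  have h3 := (ENNReal.add_le_add_iff_right ENNReal.ofReal_ne_top).1 h2
  exact (ENNReal.mul_le_mul_iff_right (by simpa using hab) ENNReal.ofReal_ne_top).1 h3

/-- Mirror image: a slope of at most `-s` gives the call spread mass at least `s`, leaving at most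
`1 - s` for its complement. -/
theorem lintegral_one_sub_ramp_le (μ : Measure ℝ) [IsProbabilityMeasure μ] {a b s A B : ℝ}
    (hab : a < b) (hs' : s ≤ 1)
    (hA : ∫⁻ x, ENNReal.ofReal (max (x - a) 0) ∂μ = ENNReal.ofReal A)
    (hB : 0 ≤ B)
    (hB' : ∫⁻ x, ENNReal.ofReal (max (x - b) 0) ∂μ = ENNReal.ofReal B)
    (hA0 : 0 ≤ A) (h : B + s * (b - a) ≤ A) :
    ∫⁻ x, ENNReal.ofReal (1 - ramp a b x) ∂μ ≤ ENNReal.ofReal (1 - s) := by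
  have mu : Measurable fun x => ENNReal.ofReal (1 - ramp a b x) :=
    (measurable_const.sub (measurable_ramp a b)).ennreal_ofReal
  have h1 : ENNReal.ofReal (b - a) * (∫⁻ x, ENNReal.ofReal (1 - ramp a b x) ∂μ) +
      ENNReal.ofReal A = ENNReal.ofReal (b - a + B) := by
    have hc : ENNReal.ofReal (b - a) = ∫⁻ _, ENNReal.ofReal (b - a) ∂μ := by simp
    rw [ENNReal.ofReal_add (by linarith) hB, ← hA, ← hB', ← lintegral_const_mul _ mu,
      ← lintegral_add_left (by fun_prop), hc, ← lintegral_add_left (by fun_prop)]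
    simp only [lintegral_const, measure_univ, mul_one]
    refine lintegral_congr fun x => ?_
    rw [← ENNReal.ofReal_mul (by linarith), ← ENNReal.ofReal_add _ (le_max_right _ _),
      ← ENNReal.ofReal_add (by linarith) (le_max_right _ _)]
    · congr 1
      linarith [mul_ramp (x := x) hab]
    · exact mul_nonneg (by linarith) (by linarith [ramp_le_one a b x])
  have h2 : ENNReal.ofReal (b - a) * (∫⁻ x, ENNReal.ofReal (1 - ramp a b x) ∂μ) +
      ENNReal.ofReal A ≤ ENNReal.ofReal (b - a) * ENNReal.ofReal (1 - s) + ENNReal.ofReal A := by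
    rw [h1, ← ENNReal.ofReal_mul (by linarith),
      ← ENNReal.ofReal_add (mul_nonneg (by linarith) (by linarith)) hA0]
    exact ENNReal.ofReal_le_ofReal (by linarith)
  have h3 := (ENNReal.add_le_add_iff_right ENNReal.ofReal_ne_top).1 h2
  exact (ENNReal.mul_le_mul_iff_right (by simpa using hab) ENNReal.ofReal_ne_top).1 h3

/-- If `h ≤ p j + s K j` for all `j`, some law with the same call prices as `μ` is a mixture
`s ν + (1 - s) ρ` with `s E_ν x ≥ h`. -/
theorem exists_mixture_le_mean {m : ℕ} (K p : Fin m → ℝ) (μ : Measure ℝ) [IsProbabilityMeasure μ]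
    (hμ : ∀ᵐ x ∂μ, 0 ≤ x) (hK : ∀ j, 0 ≤ K j) (hp : ∀ j, 0 ≤ p j)
    (hprice : ∀ j, ∫⁻ x, ENNReal.ofReal (max (x - K j) 0) ∂μ = ENNReal.ofReal (p j))
    {s h : ℝ} (hs : 0 < s) (hs' : s < 1) (hh : 0 ≤ h) (hle : ∀ j, h ≤ p j + s * K j) :
    ∃ ν ρ : Measure ℝ, IsProbabilityMeasure ν ∧ IsProbabilityMeasure ρ ∧
      (∀ᵐ x ∂ν, 0 ≤ x) ∧ (∀ᵐ x ∂ρ, 0 ≤ x) ∧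
      (∀ j, ENNReal.ofReal s * ∫⁻ x, ENNReal.ofReal (max (x - K j) 0) ∂ν +
          ENNReal.ofReal (1 - s) * ∫⁻ x, ENNReal.ofReal (max (x - K j) 0) ∂ρ =
          ENNReal.ofReal (p j)) ∧
      ENNReal.ofReal h ≤ ENNReal.ofReal s * ∫⁻ x, ENNReal.ofReal x ∂ν := by
  rcases isEmpty_or_nonempty (Fin m) with hm | hm
  · refine ⟨Measure.dirac (h / s), Measure.dirac 0, inferInstance, inferInstance, ?_, ?_,
      fun j => hm.elim j, ?_⟩
    · exact (ae_dirac_iff measurableSet_Ici).2 (div_nonneg hh hs.le)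
    · exact (ae_dirac_iff measurableSet_Ici).2 (le_refl (0 : ℝ))
    · rw [lintegral_dirac, ← ENNReal.ofReal_mul hs.le, mul_div_cancel₀ _ hs.ne']
  -- The tightest bound on `h` selects the strike at which to split.
  obtain ⟨j₀, hj₀⟩ := Finite.exists_min fun j => p j + s * K j
  obtain ⟨b, hb, hbK, hbu⟩ : ∃ b, K j₀ < b ∧ (∀ j, K j₀ < K j → b ≤ K j) ∧
      ∫⁻ x, ENNReal.ofReal (ramp (K j₀) b x) ∂μ ≤ ENNReal.ofReal s := by
    by_cases hex : ∃ j, K j₀ < K j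
    · obtain ⟨j₁, hj₁, hmin⟩ := Set.exists_min_image {j | K j₀ < K j} K (Set.toFinite _) hex
      refine ⟨K j₁, hj₁, fun j hj => hmin j hj, ?_⟩
      exact lintegral_ramp_le μ hj₁ hs.le (hp j₁) (hprice j₀) (hprice j₁).ge
        (by linarith [hj₀ j₁])
    · push Not at hex
      -- Without a higher strike `b` is free: `s * (b - K j₀) ≥ p j₀` is needed, and the `+ 1` keeps
      -- `b > K j₀` when the price is zero.
      refine ⟨K j₀ + (p j₀ / s + 1), ?_, fun j hj => absurd hj (hex j).not_gt, ?_⟩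
      · have := div_nonneg (hp j₀) hs.le
        linarith
      · have := div_nonneg (hp j₀) hs.le
        refine lintegral_ramp_le μ (by linarith) hs.le le_rfl (hprice j₀) (by simp) ?_
        have h2 : s * (p j₀ / s) = p j₀ := mul_div_cancel₀ _ hs.ne'
        linarith
  obtain ⟨a, ha, haK, hak, hal⟩ : ∃ a, 0 ≤ a ∧ a ≤ K j₀ ∧
      (∀ j, K j < K j₀ → a < K j₀ ∧ K j ≤ a) ∧
      ∫⁻ x, ENNReal.ofReal (lowerRamp a (K j₀) x) ∂μ ≤ ENNReal.ofReal (1 - s) := by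
    by_cases hex : ∃ j, K j < K j₀
    · obtain ⟨j₁, hj₁, hmax⟩ := Set.exists_max_image {j | K j < K j₀} K (Set.toFinite _) hex
      have hj₁' : K j₁ < K j₀ := hj₁
      refine ⟨K j₁, hK j₁, hj₁'.le, fun j hj => ⟨hj₁', hmax j hj⟩, ?_⟩
      simp only [lowerRamp, if_pos hj₁']
      exact lintegral_one_sub_ramp_le μ hj₁' hs'.le (hprice j₁) (hp j₀) (hprice j₀) (hp j₁)
        (by linarith [hj₀ j₁])
    · push Not at hex
      refine ⟨K j₀, hK j₀, le_rfl, fun j hj => absurd hj (hex j).not_gt, ?_⟩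
      simp [lowerRamp]
  obtain ⟨ν, ρ, h1, h2, h3, h4, h5, h6⟩ :=
    exists_mixture_of_spread μ hμ hs hs' ha haK hb hbu hal
  refine ⟨ν, ρ, h1, h2, h3, h4, fun j => ?_, ?_⟩
  · rw [h5 (K j), hprice]
    rcases lt_trichotomy (K j) (K j₀) with h | h | h
    · exact Or.inr (Or.inr (hak j h))
    · exact Or.inl h
    · exact Or.inr (Or.inl (hbK j h))
  · rw [h6, hprice, ← ENNReal.ofReal_add (hp j₀) (mul_nonneg hs.le (hK j₀))]
    exact ENNReal.ofReal_le_ofReal (hle j₀)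

/-! ### From an LP point to a pricing measure -/

theorem lintegral_pi_eval {n : ℕ} (ν : Fin n → Measure ℝ) [∀ i, IsProbabilityMeasure (ν i)]
    (i : Fin n) {f : ℝ → ℝ≥0∞} (hf : Measurable f) :
    ∫⁻ x, f (x i) ∂(Measure.pi ν) = ∫⁻ y, f y ∂(ν i) :=
  (measurePreserving_eval ν i).lintegral_comp hf

theorem ae_pi_nonneg {n : ℕ} (ν : Fin n → Measure ℝ) [∀ i, IsProbabilityMeasure (ν i)]
    (h : ∀ i, ∀ᵐ x ∂(ν i), 0 ≤ x) : ∀ᵐ x ∂(Measure.pi ν), ∀ i, 0 ≤ x i :=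
  ae_all_iff.2 fun i => (measurePreserving_eval ν i).quasiMeasurePreserving.ae (h i)

/-- A pricing measure whose basket call price dominates `h ⬝ᵥ w₀ - s K₀`, for `0 < s < 1`. -/
theorem exists_pricingMeasure_le_basketCallPrice {n : ℕ} {J : Fin n → ℕ}
    {K p : (i : Fin n) → Fin (J i) → ℝ} {w₀ : Fin n → ℝ} {K₀ : ℝ}
    (hK : ∀ i j, 0 ≤ K i j) (hp : ∀ i j, 0 ≤ p i j) (hw₀ : ∀ i, 0 ≤ w₀ i) (hK₀ : 0 ≤ K₀)
    {π : Measure (Fin n → ℝ)} (hπ : IsPricingMeasure J K p π)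
    {s : ℝ} (hs : 0 < s) (hs' : s < 1) {h : Fin n → ℝ} (hh : ∀ i, 0 ≤ h i)
    (hle : ∀ i j, h i ≤ p i j + s * K i j) :
    ∃ π' : Measure (Fin n → ℝ), IsPricingMeasure J K p π' ∧
      ((h ⬝ᵥ w₀ - s * K₀ : ℝ) : EReal) ≤ (basketCallPrice w₀ K₀ π' : EReal) := by
  have := hπ.prob
  have key : ∀ i, ∃ ν ρ : Measure ℝ, IsProbabilityMeasure ν ∧ IsProbabilityMeasure ρ ∧
      (∀ᵐ x ∂ν, 0 ≤ x) ∧ (∀ᵐ x ∂ρ, 0 ≤ x) ∧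
      (∀ j, ENNReal.ofReal s * ∫⁻ x, ENNReal.ofReal (max (x - K i j) 0) ∂ν +
          ENNReal.ofReal (1 - s) * ∫⁻ x, ENNReal.ofReal (max (x - K i j) 0) ∂ρ =
          ENNReal.ofReal (p i j)) ∧
      ENNReal.ofReal (h i) ≤ ENNReal.ofReal s * ∫⁻ x, ENNReal.ofReal x ∂ν := by
    intro i
    have mi : Measurable fun x : Fin n → ℝ => x i := measurable_pi_apply i
    have : IsProbabilityMeasure (π.map fun x => x i) :=
      Measure.isProbabilityMeasure_map mi.aemeasurable
    refine exists_mixture_le_mean (K i) (p i) (π.map fun x => x i) ?_ (hK i) (hp i) ?_ hs hs'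
      (hh i) (hle i)
    · rw [ae_map_iff mi.aemeasurable measurableSet_Ici]
      filter_upwards [hπ.nonneg] with x hx using hx i
    · intro j
      rw [lintegral_map (by fun_prop) mi]
      exact hπ.price i j
  choose ν ρ hν hρ hν0 hρ0 hprice hmean using key
  -- Only the marginals within each part matter, so the product is merely a convenient coupling; the
  -- common weight `s` is essential.
  set π' : Measure (Fin n → ℝ) := ENNReal.ofReal s • Measure.pi ν +
    ENNReal.ofReal (1 - s) • Measure.pi ρ with hπ'
  have hint : ∀ f : (Fin n → ℝ) → ℝ≥0∞, ∫⁻ x, f x ∂π' =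
      ENNReal.ofReal s * ∫⁻ x, f x ∂(Measure.pi ν) +
        ENNReal.ofReal (1 - s) * ∫⁻ x, f x ∂(Measure.pi ρ) := by
    intro f
    rw [hπ', lintegral_add_measure, lintegral_smul_measure, lintegral_smul_measure, smul_eq_mul,
      smul_eq_mul]
  refine ⟨π', ⟨⟨?_⟩, ?_, ?_⟩, ?_⟩
  · rw [← lintegral_one, hint]
    simp only [lintegral_const, measure_univ, mul_one]
    rw [← ENNReal.ofReal_add hs.le (by linarith)]; simp
  · rw [hπ', ae_add_measure_iff]
    exact ⟨Measure.ae_smul_measure (ae_pi_nonneg ν hν0) _,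
      Measure.ae_smul_measure (ae_pi_nonneg ρ hρ0) _⟩
  · intro i j
    rw [hint, ← hprice i j, ← lintegral_pi_eval ν i (by fun_prop),
      ← lintegral_pi_eval ρ i (by fun_prop)]
  · have hdot : ENNReal.ofReal (h ⬝ᵥ w₀) ≤
        ENNReal.ofReal s * ∫⁻ x, ENNReal.ofReal (w₀ ⬝ᵥ x) ∂(Measure.pi ν) := by
      have h1 : ∫⁻ x, ENNReal.ofReal (w₀ ⬝ᵥ x) ∂(Measure.pi ν) =
          ∑ i, ENNReal.ofReal (w₀ i) * ∫⁻ x, ENNReal.ofReal x ∂(ν i) := by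
        calc _ = ∫⁻ x, ∑ i, ENNReal.ofReal (w₀ i) * ENNReal.ofReal (x i) ∂(Measure.pi ν) := by
              refine lintegral_congr_ae ?_
              filter_upwards [ae_pi_nonneg ν hν0] with x hx
              rw [dotProduct, ENNReal.ofReal_sum_of_nonneg
                fun i _ => mul_nonneg (hw₀ i) (hx i)]
              exact Finset.sum_congr rfl fun i _ => ENNReal.ofReal_mul (hw₀ i)
          _ = _ := by
              rw [lintegral_finsetSum _ fun i _ => by fun_prop]
              refine Finset.sum_congr rfl fun i _ => ?_
              rw [lintegral_const_mul _ (by fun_prop),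
                lintegral_pi_eval ν i (f := fun y => ENNReal.ofReal y) (by fun_prop)]
      rw [h1, dotProduct, ENNReal.ofReal_sum_of_nonneg
        fun i _ => mul_nonneg (hh i) (hw₀ i), Finset.mul_sum]
      refine Finset.sum_le_sum fun i _ => ?_
      rw [mul_comm (h i), ENNReal.ofReal_mul (hw₀ i), mul_left_comm]
      gcongr
      exact hmean i
    have mcall : Measurable fun x : Fin n → ℝ => ENNReal.ofReal (max (w₀ ⬝ᵥ x - K₀) 0) := by
      unfold dotProduct; fun_prop
    -- Drop the `ρ` part and use `w₀ ⬝ᵥ x ≤ (w₀ ⬝ᵥ x - K₀)₊ + K₀` on the part of mass `s`.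
    have h2 : ENNReal.ofReal (h ⬝ᵥ w₀) ≤ basketCallPrice w₀ K₀ π' + ENNReal.ofReal (s * K₀) := by
      calc _ ≤ _ := hdot
        _ ≤ ENNReal.ofReal s * ∫⁻ x, (ENNReal.ofReal (max (w₀ ⬝ᵥ x - K₀) 0) +
              ENNReal.ofReal K₀) ∂(Measure.pi ν) := by
            gcongr with x
            rw [← ENNReal.ofReal_add (le_max_right _ _) hK₀]
            exact ENNReal.ofReal_le_ofReal (by linarith [le_max_left (w₀ ⬝ᵥ x - K₀) 0])
        _ = ENNReal.ofReal s * ∫⁻ x, ENNReal.ofReal (max (w₀ ⬝ᵥ x - K₀) 0) ∂(Measure.pi ν) +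
              ENNReal.ofReal (s * K₀) := by
            rw [lintegral_add_left mcall, mul_add, ENNReal.ofReal_mul hs.le]
            simp
        _ ≤ _ := by
            rw [basketCallPrice, hint]
            gcongr
            exact le_self_add
    by_cases htop : basketCallPrice w₀ K₀ π' = ∞
    · rw [htop]; exact le_top
    · rw [← ENNReal.ofReal_toReal htop, EReal.coe_ennreal_ofReal, max_eq_left ENNReal.toReal_nonneg]
      rw [← ENNReal.ofReal_toReal htop, ← ENNReal.ofReal_add ENNReal.toReal_nonneg
        (mul_nonneg hs.le hK₀), ENNReal.ofReal_le_ofReal_iff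
        (add_nonneg ENNReal.toReal_nonneg (mul_nonneg hs.le hK₀))] at h2
      exact_mod_cast (by linarith : h ⬝ᵥ w₀ - s * K₀ ≤ (basketCallPrice w₀ K₀ π').toReal)

theorem lpUpperBound_le_exactUpperBound {n : ℕ} {J : Fin n → ℕ}
    {K p : (i : Fin n) → Fin (J i) → ℝ} {w₀ : Fin n → ℝ} {K₀ : ℝ}
    (hK : ∀ i j, 0 ≤ K i j) (hp : ∀ i j, 0 ≤ p i j) (hw₀ : ∀ i, 0 ≤ w₀ i) (hK₀ : 0 ≤ K₀)
    {π : Measure (Fin n → ℝ)} (hπ : IsPricingMeasure J K p π) :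
    lpUpperBound J K p w₀ K₀ ≤ exactUpperBound J K p w₀ K₀ := by
  refine sSup_le ?_
  rintro v ⟨p₀, q, g, hg, rfl⟩
  set h := (g (Sum.inl 0)).1 with hh
  set s := -(g (Sum.inl 0)).2 with hs
  have hs0 : 0 ≤ s := by have := (hg.slope (Sum.inl 0)).2; linarith
  have hs1 : s ≤ 1 := by have := (hg.slope (Sum.inl 0)).1; linarith
  have hhom : h ⬝ᵥ w₀ - s * K₀ = p₀ := by
    have := hg.homogeneous (Sum.inl 0)
    simp only [pairing, nodeWeight, nodeStrike, nodePrice, if_true] at this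
    rw [← this, hs]; ring
  have hle : ∀ i j, h i ≤ p i j + s * K i j := by
    intro i j
    have h1 := hg.convex (Sum.inl 0) (Sum.inr ⟨i, j⟩)
    simp only [pairing, nodeWeight, nodeStrike, nodePrice, if_true, dotProduct_sub,
      dotProduct_single_one] at h1
    linarith
  -- The slope may be `0` or `-1`, whereas both mixture weights must be positive. Moving `(h, s)` a
  -- fraction `η` towards `(0, 1/2)` keeps the constraints, as prices and strikes are nonnegative;
  -- then `η → 0`.
  have hη : ∀ η ∈ Set.Ioo (0 : ℝ) 1,
      (((1 - η) * p₀ - η / 2 * K₀ : ℝ) : EReal) ≤ exactUpperBound J K p w₀ K₀ := by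
    rintro η ⟨hη0, hη1⟩
    obtain ⟨π', hπ', hle'⟩ := exists_pricingMeasure_le_basketCallPrice hK hp hw₀ hK₀ hπ
      (s := (1 - η) * s + η / 2) (h := (1 - η) • h) (by nlinarith) (by nlinarith)
      (fun i => mul_nonneg (by linarith) (hg.mono _ i)) (fun i j => by
        have h1 : (1 - η) * h i ≤ (1 - η) * (p i j + s * K i j) :=
          mul_le_mul_of_nonneg_left (hle i j) (by linarith)
        have h2 := mul_nonneg hη0.le (hp i j)
        have h3 := mul_nonneg hη0.le (hK i j)
        simp only [Pi.smul_apply, smul_eq_mul]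
        linarith)
    refine le_trans (le_of_eq ?_) (hle'.trans (le_sSup ⟨π', hπ', rfl⟩))
    rw [smul_dotProduct, smul_eq_mul, ← hhom]
    congr 1; ring
  have hlim : Filter.Tendsto (fun η : ℝ => (((1 - η) * p₀ - η / 2 * K₀ : ℝ) : EReal))
      (nhdsWithin 0 (Set.Ioi 0)) (nhds (p₀ : EReal)) := by
    have hc : Continuous fun η : ℝ => (((1 - η) * p₀ - η / 2 * K₀ : ℝ) : EReal) :=
      continuous_coe_real_ereal.comp (by fun_prop)
    have := (hc.tendsto 0).mono_left (nhdsWithin_le_nhds (s := Set.Ioi (0 : ℝ)))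
    simpa using this
  refine le_of_tendsto hlim ?_
  filter_upwards [Ioo_mem_nhdsGT (zero_lt_one' ℝ)] with η h using hη η h

/-! ### From a pricing measure to an LP point -/

/-- The call price function of a measure with finite means and its subgradients give a feasible
point of the linear program. -/
theorem IsPricingMeasure.exists_isLPFeasible {n : ℕ} {J : Fin n → ℕ}
    {K p : (i : Fin n) → Fin (J i) → ℝ} {w₀ : Fin n → ℝ} {K₀ : ℝ}
    (hp : ∀ i j, 0 ≤ p i j) (hw₀ : ∀ i, 0 ≤ w₀ i)
    {π : Measure (Fin n → ℝ)} (hπ : IsPricingMeasure J K p π)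
    (hint : ∀ i, Integrable (fun x => x i) π) :
    ∃ (q : Fin n → ℝ) (g : Node J → (Fin n → ℝ) × ℝ),
      IsLPFeasible J K p w₀ K₀ (∫ x, max (w₀ ⬝ᵥ x - K₀) 0 ∂π) q g := by
  have := hπ.prob
  have hdot : ∀ w : Fin n → ℝ, Integrable (fun x => w ⬝ᵥ x) π := fun w =>
    integrable_finsetSum _ fun i _ => (hint i).const_mul (w i)
  have hlin : ∀ (w : Fin n → ℝ) (k : ℝ), Integrable (fun x => w ⬝ᵥ x - k) π := fun w k =>
    (hdot w).sub (integrable_const k)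
  have hcall : ∀ (w : Fin n → ℝ) (k : ℝ), Integrable (fun x => max (w ⬝ᵥ x - k) 0) π :=
    fun w k => (hlin w k).pos_part
  -- `A a` is the exercise region of option `a`. Exercising any other option on `A a` is worth at
  -- most its price, with equality for `a` itself: this is the subgradient inequality.
  set A : Node J → Set (Fin n → ℝ) :=
    fun a => {x | nodeStrike J K K₀ a < nodeWeight J w₀ a ⬝ᵥ x} with hA
  have mA : ∀ a, MeasurableSet (A a) := fun a =>
    measurableSet_lt measurable_const (by unfold dotProduct; fun_prop)
  set q : Fin n → ℝ := fun i => ∫ x, x i ∂π with hq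
  set g : Node J → (Fin n → ℝ) × ℝ := fun a => (fun i => ∫ x in A a, x i ∂π, -π.real (A a)) with hg
  have hpair : ∀ a w k, pairing (g a) w k = ∫ x in A a, (w ⬝ᵥ x - k) ∂π := by
    intro a w k
    rw [integral_sub (hdot w).integrableOn (integrable_const k).integrableOn, setIntegral_const]
    simp only [dotProduct, pairing, hg]
    rw [integral_finsetSum _ fun i _ => ((hint i).const_mul (w i)).integrableOn]
    simp only [integral_const_mul, smul_eq_mul]
    rw [sub_eq_add_neg, neg_mul]
    congr 1
    exact Finset.sum_congr rfl fun i _ => mul_comm _ _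
  have hcallint : ∀ i j, ∫ x, max (x i - K i j) 0 ∂π = p i j := by
    intro i j
    rw [integral_eq_lintegral_of_nonneg_ae (Filter.Eventually.of_forall fun x => le_max_right (_ : ℝ) 0)
      (Measurable.aestronglyMeasurable (by fun_prop)), hπ.price i j, ENNReal.toReal_ofReal (hp i j)]
  have hprice : ∀ a, nodePrice J p w₀ (∫ x, max (w₀ ⬝ᵥ x - K₀) 0 ∂π) q a =
      ∫ x, max (nodeWeight J w₀ a ⬝ᵥ x - nodeStrike J K K₀ a) 0 ∂π := by
    rintro (l | ⟨i, j⟩)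
    · by_cases hl : l = 0
      · simp [nodePrice, nodeWeight, nodeStrike, hl]
      · simp only [nodePrice, nodeWeight, nodeStrike, hl, if_false, sub_zero]
        calc _ = ∫ x, w₀ ⬝ᵥ x ∂π := by
              simp only [dotProduct, hq]
              rw [integral_finsetSum _ fun i _ => (hint i).const_mul (w₀ i)]
              simp only [integral_const_mul]
          _ = _ := by
              refine integral_congr_ae ?_
              filter_upwards [hπ.nonneg] with x hx
              exact (max_eq_left (Finset.sum_nonneg fun i _ => mul_nonneg (hw₀ i) (hx i))).symm
    · simp only [nodePrice, nodeWeight, nodeStrike, single_one_dotProduct]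
      exact (hcallint i j).symm
  have hle : ∀ a w k, pairing (g a) w k ≤ ∫ x, max (w ⬝ᵥ x - k) 0 ∂π := by
    intro a w k
    rw [hpair]
    calc _ ≤ ∫ x in A a, max (w ⬝ᵥ x - k) 0 ∂π :=
          integral_mono (hlin w k).integrableOn (hcall w k).integrableOn fun x => le_max_left _ _
      _ ≤ _ := setIntegral_le_integral (hcall w k)
          (Filter.Eventually.of_forall fun x => le_max_right (_ : ℝ) 0)
  have heq : ∀ a, pairing (g a) (nodeWeight J w₀ a) (nodeStrike J K K₀ a) =
      ∫ x, max (nodeWeight J w₀ a ⬝ᵥ x - nodeStrike J K K₀ a) 0 ∂π := by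
    intro a
    rw [hpair, ← integral_indicator (mA a)]
    refine integral_congr_ae (Filter.Eventually.of_forall fun x => ?_)
    by_cases hx : x ∈ A a
    · have hx' : nodeStrike J K K₀ a < nodeWeight J w₀ a ⬝ᵥ x := hx
      simp only [Set.indicator_of_mem hx]
      rw [max_eq_left (by linarith)]
    · have hx' : nodeWeight J w₀ a ⬝ᵥ x ≤ nodeStrike J K K₀ a := not_lt.1 hx
      simp only [Set.indicator_of_notMem hx]
      rw [max_eq_right (by linarith)]
  refine ⟨q, g, ?_, ?_, ?_, ?_, ?_, ?_, ?_⟩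
  · exact integral_nonneg fun x => le_max_right (_ : ℝ) 0
  · intro i
    refine integral_nonneg_of_ae ?_
    filter_upwards [hπ.nonneg] with x hx using hx i
  · intro i j hij
    rw [← hcallint i j]
    refine integral_congr_ae ?_
    filter_upwards [hπ.nonneg] with x hx
    rw [hij, sub_zero, max_eq_left (hx i)]
  · intro a b
    have hsub : pairing (g a) (nodeWeight J w₀ b - nodeWeight J w₀ a)
        (nodeStrike J K K₀ b - nodeStrike J K K₀ a) =
        pairing (g a) (nodeWeight J w₀ b) (nodeStrike J K K₀ b) -
          pairing (g a) (nodeWeight J w₀ a) (nodeStrike J K K₀ a) := by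
      simp only [pairing, dotProduct_sub]; ring
    rw [hsub, hprice, hprice, heq]
    linarith [hle a (nodeWeight J w₀ b) (nodeStrike J K K₀ b)]
  · intro a i
    refine integral_nonneg_of_ae (ae_restrict_of_ae ?_)
    filter_upwards [hπ.nonneg] with x hx using hx i
  · intro a
    exact ⟨neg_le_neg measureReal_le_one, neg_nonpos.2 measureReal_nonneg⟩
  · intro a
    rw [heq, hprice]

/-! ### Removing the finite-mean assumption by capping -/

/-- An asset with a quoted call has a finite mean. -/
theorem IsPricingMeasure.integrable_eval {n : ℕ} {J : Fin n → ℕ}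
    {K p : (i : Fin n) → Fin (J i) → ℝ} {π : Measure (Fin n → ℝ)} (hπ : IsPricingMeasure J K p π)
    (i : Fin n) (j : Fin (J i)) : Integrable (fun x => x i) π := by
  have := hπ.prob
  have h1 : Integrable (fun x : Fin n → ℝ => max (x i - K i j) 0) π := by
    refine ⟨Measurable.aestronglyMeasurable (by fun_prop), ?_⟩
    rw [hasFiniteIntegral_iff_ofReal (Filter.Eventually.of_forall fun x => le_max_right (_ : ℝ) 0),
      hπ.price i j]
    exact ENNReal.ofReal_lt_top
  refine (h1.add (integrable_const |K i j|)).mono'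
      (measurable_pi_apply i).aestronglyMeasurable ?_
  filter_upwards [hπ.nonneg] with x hx
  rw [Real.norm_eq_abs, abs_of_nonneg (hx i)]
  simp only [Pi.add_apply]
  linarith [le_max_left (x i - K i j) 0, le_abs_self (K i j)]

/-- Cap the assets without quoted calls at level `N`. -/
def capUnquoted {n : ℕ} (J : Fin n → ℕ) (N : ℕ) (x : Fin n → ℝ) : Fin n → ℝ :=
  fun i => if J i = 0 then min (x i) N else x i

theorem measurable_capUnquoted {n : ℕ} (J : Fin n → ℕ) (N : ℕ) :
    Measurable (capUnquoted J N) := by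
  refine measurable_pi_iff.2 fun i => ?_
  unfold capUnquoted
  split_ifs <;> fun_prop

theorem IsPricingMeasure.map_capUnquoted {n : ℕ} {J : Fin n → ℕ}
    {K p : (i : Fin n) → Fin (J i) → ℝ} {π : Measure (Fin n → ℝ)} (hπ : IsPricingMeasure J K p π)
    (N : ℕ) : IsPricingMeasure J K p (π.map (capUnquoted J N)) := by
  have := hπ.prob
  have hm := measurable_capUnquoted J N
  refine ⟨Measure.isProbabilityMeasure_map hm.aemeasurable, ?_, ?_⟩
  · rw [ae_all_iff]
    intro i
    rw [ae_map_iff hm.aemeasurable (measurableSet_le measurable_const (measurable_pi_apply i))]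
    filter_upwards [hπ.nonneg] with x hx
    unfold capUnquoted
    split_ifs
    · exact le_min (hx i) (Nat.cast_nonneg N)
    · exact hx i
  · intro i j
    have hJ : J i ≠ 0 := fun h => (Fin.cast h j).elim0
    rw [lintegral_map (by fun_prop) hm, ← hπ.price i j]
    simp [capUnquoted, hJ]

theorem IsPricingMeasure.integrable_map_capUnquoted {n : ℕ} {J : Fin n → ℕ}
    {K p : (i : Fin n) → Fin (J i) → ℝ} {π : Measure (Fin n → ℝ)} (hπ : IsPricingMeasure J K p π)
    (N : ℕ) (i : Fin n) : Integrable (fun x => x i) (π.map (capUnquoted J N)) := by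
  by_cases hJ : J i = 0
  · have hπ' := hπ.map_capUnquoted N
    have := hπ'.prob
    have hm := measurable_capUnquoted J N
    refine (integrable_const (N : ℝ)).mono'
      (measurable_pi_apply i).aestronglyMeasurable ?_
    have hN : ∀ᵐ x ∂(π.map (capUnquoted J N)), x i ≤ (N : ℝ) := by
      rw [ae_map_iff hm.aemeasurable (measurableSet_le (measurable_pi_apply i) measurable_const)]
      refine Filter.Eventually.of_forall fun x => ?_
      simp [capUnquoted, hJ]
    filter_upwards [hN, hπ'.nonneg] with x hx hx0
    rwa [Real.norm_eq_abs, abs_of_nonneg (hx0 i)]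
  · exact (hπ.map_capUnquoted N).integrable_eval i ⟨0, Nat.pos_of_ne_zero hJ⟩

/-- Monotone convergence: nonnegative weights make the capped payoff increase with the level, and at
each point it is eventually the uncapped one. The limit may be infinite. -/
theorem tendsto_basketCallPrice_map_capUnquoted {n : ℕ} (J : Fin n → ℕ) {w : Fin n → ℝ}
    (hw : ∀ i, 0 ≤ w i) (k : ℝ) (π : Measure (Fin n → ℝ)) :
    Filter.Tendsto (fun N => basketCallPrice w k (π.map (capUnquoted J N))) Filter.atTop
      (nhds (basketCallPrice w k π)) := by
  have mcall : Measurable fun x : Fin n → ℝ => ENNReal.ofReal (max (w ⬝ᵥ x - k) 0) := by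
    unfold dotProduct; fun_prop
  have hcap : ∀ N, basketCallPrice w k (π.map (capUnquoted J N)) =
      ∫⁻ x, ENNReal.ofReal (max (w ⬝ᵥ capUnquoted J N x - k) 0) ∂π := fun N =>
    lintegral_map mcall (measurable_capUnquoted J N)
  simp only [hcap]
  refine lintegral_tendsto_of_tendsto_of_monotone
    (fun N => (mcall.comp (measurable_capUnquoted J N)).aemeasurable) ?_ ?_
  · refine Filter.Eventually.of_forall fun x M N hMN => ?_
    refine ENNReal.ofReal_le_ofReal (max_le_max_right _ (sub_le_sub_right ?_ _))
    refine Finset.sum_le_sum fun i _ => mul_le_mul_of_nonneg_left ?_ (hw i)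
    unfold capUnquoted
    split_ifs
    · exact min_le_min_left _ (Nat.cast_le.2 hMN)
    · exact le_rfl
  · refine Filter.Eventually.of_forall fun x => ?_
    refine tendsto_nhds_of_eventually_eq ?_
    have h : ∀ᶠ N : ℕ in Filter.atTop, ∀ i, x i ≤ N := by
      rw [Filter.eventually_all]
      exact fun i => tendsto_natCast_atTop_atTop.eventually_ge_atTop (x i)
    filter_upwards [h] with N hN
    have : capUnquoted J N x = x := by
      ext i
      simp [capUnquoted, hN i]
    rw [this]

theorem IsPricingMeasure.basketCallPrice_le_lpUpperBound {n : ℕ} {J : Fin n → ℕ}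
    {K p : (i : Fin n) → Fin (J i) → ℝ} {w₀ : Fin n → ℝ} {K₀ : ℝ}
    (hp : ∀ i j, 0 ≤ p i j) (hw₀ : ∀ i, 0 ≤ w₀ i)
    {π : Measure (Fin n → ℝ)} (hπ : IsPricingMeasure J K p π)
    (hint : ∀ i, Integrable (fun x => x i) π) :
    (basketCallPrice w₀ K₀ π : EReal) ≤ lpUpperBound J K p w₀ K₀ := by
  have := hπ.prob
  obtain ⟨q, g, hg⟩ := hπ.exists_isLPFeasible (K₀ := K₀) hp hw₀ hint
  refine le_trans (le_of_eq ?_) (le_sSup ⟨_, q, g, hg, rfl⟩)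
  have hcall : Integrable (fun x => max (w₀ ⬝ᵥ x - K₀) 0) π :=
    ((integrable_finsetSum _ fun i _ => (hint i).const_mul (w₀ i)).sub
      (integrable_const K₀)).pos_part
  rw [basketCallPrice, ← ofReal_integral_eq_lintegral_ofReal hcall
    (Filter.Eventually.of_forall fun x => le_max_right (_ : ℝ) 0), EReal.coe_ennreal_ofReal,
    max_eq_left (integral_nonneg fun x => le_max_right (_ : ℝ) 0)]

theorem exactUpperBound_le_lpUpperBound {n : ℕ} {J : Fin n → ℕ}
    {K p : (i : Fin n) → Fin (J i) → ℝ} {w₀ : Fin n → ℝ} {K₀ : ℝ}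
    (hp : ∀ i j, 0 ≤ p i j) (hw₀ : ∀ i, 0 ≤ w₀ i) :
    exactUpperBound J K p w₀ K₀ ≤ lpUpperBound J K p w₀ K₀ := by
  refine sSup_le ?_
  rintro v ⟨π, hπ, rfl⟩
  have hlim := (continuous_coe_ennreal_ereal.tendsto _).comp
    (tendsto_basketCallPrice_map_capUnquoted J hw₀ K₀ π)
  exact le_of_tendsto' hlim fun N =>
    (hπ.map_capUnquoted N).basketCallPrice_le_lpUpperBound hp hw₀
      (hπ.integrable_map_capUnquoted N)

theorem mainTheorem1 {n : ℕ} (J : Fin n → ℕ) (K p : (i : Fin n) → Fin (J i) → ℝ)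
    (w₀ : Fin n → ℝ) (K₀ : ℝ)
    (hK : ∀ i j, 0 ≤ K i j) (hp : ∀ i j, 0 ≤ p i j) (hw₀ : ∀ i, 0 < w₀ i) (hK₀ : 0 ≤ K₀)
    (hfeas : ∃ π : MeasureTheory.Measure (Fin n → ℝ), IsPricingMeasure J K p π) :
    exactUpperBound J K p w₀ K₀ = lpUpperBound J K p w₀ K₀ := by
  obtain ⟨π, hπ⟩ := hfeas
  exact le_antisymm (exactUpperBound_le_lpUpperBound hp fun i => (hw₀ i).le)
    (lpUpperBound_le_exactUpperBound hK hp (fun i => (hw₀ i).le) hK₀ hπ)
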